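/- Let $n\ge 2$ and $m\ge 3$, and let $w_1,\dots,w_{n+1}\in\mathbb R^n$ be a regular simplex frame: $w_i^{\mathsf T}w_i=1$ for all $i$ and $w_i^{\mathsf T}w_j=-1/n$ for $i\ne j$. Let $S=\sum_{i=1}^{n+1}w_i^{\circ m}$ be the regular simplex tensor of order $m$, where $a^{\circ m}$ has entries $a_{i_1}\cdots a_{i_m}$. For a tensor $S=(s_{i_1,\dots,i_m})$ and $v\in\mathbb R^n$, write $Sv^{m-1}$ for the vector with entries $\sum_{i_2,\dots,i_m}s_{j,i_2,\dots,i_m}v_{i_2}\cdots v_{i_m}$ and $Sv^{m-2}$ for the matrix with entries $\sum_{i_3,\dots,i_m}s_{i,j,i_3,\dots,i_m}v_{i_3}\cdots v_{i_m}$. A (real) eigenpair of $S$ is a pair $(\lambda,v)\in\mathbb R\times\mathbb R^n$ with $Sv^{m-1}=\lambda v$ and $v^{\mathsf T}v=1$. It is robust if $\lambda\ne0$ and the spectral radius of $J(v)=\frac{m-1}{\lambda}\left(Sv^{m-2}-\lambda vv^{\mathsf T}\right)$ is less than $1$; then $v$ is called a robust eigenvector. (1) If $n+m\ge 7$, the robust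 eigenvectors of $S$ are exactly the vectors $\pm w_j$, $1\le j\le n+1$; if $n+m<7$, there are no robust eigenvectors. (2) If only eigenpairs with $\lambda>0$ are considered and $n+m\ge7$, the robust eigenvectors are exactly the frame vectors $w_j$ when $m$ is odd, and exactly the vectors $\pm w_j$ when $m$ is even; if $n+m<7$, there are none. (3) For each $j$, $w_j$ is an eigenvector with eigenvalue $\lambda=1+\frac{n}{(-n)^m}>0$. The eigenvalues of $J(w_j)$, counted with multiplicity, are $0$ (once) and $\frac{(n+1)(m-1)}{1+(-n)^{m-2}n}$ ($n-1$ times). Consequently $$\rho(J(w_j))=\begin{cases}\dfrac{(n+1)(m-1)}{n^{m-1}-1}, & m\text{ odd},\\[2mm] \dfrac{(n+1)(m-1)}{n^{m-1}+1}, & m\text{ even}.\end{cases}$$ -/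

import Mathlib

/-- Real tensors of order `m` and dimension `n`, as arrays `s_{i₁,…,i_m}` of real entries. -/
abbrev RTensor (m n : ℕ) : Type := (Fin m → Fin n) → ℝ

/-- The `m`-fold outer power `a ∘ a ∘ ⋯ ∘ a`, with entries `a_{i₁} a_{i₂} ⋯ a_{i_m}`. -/
def outerPower {n : ℕ} (m : ℕ) (a : Fin n → ℝ) : RTensor m n :=
  fun idx => ∏ k, a (idx k)

/-- The vector `S v^{m-1}` (for `m ≥ 1`):
`(S v^{m-1})_j = ∑_{i₂,…,i_m} s_{j,i₂,…,i_m} v_{i₂} ⋯ v_{i_m}`. -/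
def RTensor.applyVec {m n : ℕ} (S : RTensor m n) (v : Fin n → ℝ) : Fin n → ℝ :=
  fun j => ∑ idx : Fin (m - 1) → Fin n,
    S (fun k => if h : k.val = 0 then j
      else idx ⟨k.val - 1, by have := k.isLt; omega⟩) * ∏ k, v (idx k)

/-- The matrix `S v^{m-2}` (for `m ≥ 2`):
`(S v^{m-2})_{i,j} = ∑_{i₃,…,i_m} s_{i,j,i₃,…,i_m} v_{i₃} ⋯ v_{i_m}`. -/
def RTensor.applyMat {m n : ℕ} (S : RTensor m n) (v : Fin n → ℝ) :
    Matrix (Fin n) (Fin n) ℝ :=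
  Matrix.of fun i j => ∑ idx : Fin (m - 2) → Fin n,
    S (fun k => if h₀ : k.val = 0 then i else if h₁ : k.val = 1 then j
      else idx ⟨k.val - 2, by have := k.isLt; omega⟩) * ∏ k, v (idx k)

/-- `(ev, v)` is a (real) eigenpair of `S`: `S v^{m-1} = ev • v` and `vᵀ v = 1`. -/
def IsEigenpair {m n : ℕ} (S : RTensor m n) (ev : ℝ) (v : Fin n → ℝ) : Prop :=
  S.applyVec v = ev • v ∧ v ⬝ᵥ v = 1

/-- The Jacobian matrix `J(v) = (m-1)/ev • (S v^{m-2} - ev • v vᵀ)` at an eigenpair `(ev, v)`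
with `ev ≠ 0`. -/
noncomputable def jacobianAt {m n : ℕ} (S : RTensor m n) (ev : ℝ) (v : Fin n → ℝ) :
    Matrix (Fin n) (Fin n) ℝ :=
  (((m : ℝ) - 1) / ev) • (S.applyMat v - ev • Matrix.vecMulVec v v)

/-- The spectral radius of a real square matrix: the maximal modulus of its complex eigenvalues. -/
noncomputable def matrixSpectralRadius {n : ℕ} (A : Matrix (Fin n) (Fin n) ℝ) : ENNReal :=
  spectralRadius ℂ (A.map (fun x : ℝ => (x : ℂ)))

/-- A robust eigenpair: an eigenpair with nonzero eigenvalue at which the spectral radius of the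
Jacobian matrix is less than `1`. -/
def IsRobustEigenpair {m n : ℕ} (S : RTensor m n) (ev : ℝ) (v : Fin n → ℝ) : Prop :=
  IsEigenpair S ev v ∧ ev ≠ 0 ∧ matrixSpectralRadius (jacobianAt S ev v) < 1

/-- A robust eigenvector: the vector of some robust eigenpair. -/
def IsRobustEigenvector {m n : ℕ} (S : RTensor m n) (v : Fin n → ℝ) : Prop :=
  ∃ ev : ℝ, IsRobustEigenpair S ev v

/-- A regular simplex frame: `n + 1` unit vectors in `ℝⁿ` with pairwise inner products `-1/n`. -/
def IsRegularSimplexFrame {n : ℕ} (w : Fin (n + 1) → Fin n → ℝ) : Prop :=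
  (∀ i, w i ⬝ᵥ w i = 1) ∧ ∀ i j, i ≠ j → w i ⬝ᵥ w j = -1 / (n : ℝ)

/-- The regular simplex tensor `S = ∑_{i=1}^{n+1} w_i^{∘ m}`. -/
def simplexTensor {n : ℕ} (m : ℕ) (w : Fin (n + 1) → Fin n → ℝ) : RTensor m n :=
  fun idx => ∑ i, outerPower m (w i) idx

/-!
In the frame coordinates `xᵢ = wᵢ ⬝ᵥ v`, an eigenpair `(ev, v)` of the simplex tensor is a critical
point of `∑ xᵢ ^ m` on the sphere of the hyperplane `∑ xᵢ = 0`: each `xᵢ ^ (m - 1)` equals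
`μ * xᵢ + c` for common constants `μ` and `c`. Up to the sign of `v` the eigenvalue is positive, and
then `ρ(J(v)) < 1` makes the Hessian negative definite on the tangent space.

Three distinct values among the `xᵢ` are impossible: for even `m - 1` because a strictly convex
function meets a line at most twice, for odd `m - 1` because by Rolle's theorem the Hessian at a
suitable tangent vector is a positive multiple of a value of the fifth derivative of `t ^ (m - 1)`,
which is nonnegative. By the mean value theorem, two values cannot both be attained twice. So all
but one of the `xᵢ` agree, which means `v = ± w j`. There the Jacobian is a multiple of the
orthogonal projection along `w j`.
-/

open Matrix Polynomial

theorem exists_isRoot_iterate_derivative_of_lt_card_roots (p : ℝ[X]) {k : ℕ}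
    (h : k < p.roots.card) : ∃ x, (derivative^[k] p).IsRoot x := by
  induction k generalizing p with
  | zero =>
    obtain ⟨x, hx⟩ := Multiset.card_pos_iff_exists_mem.1 h
    exact ⟨x, isRoot_of_mem_roots hx⟩
  | succ k ih =>
    have hroots := card_roots_le_derivative p
    exact ih (derivative p) (by omega)

theorem two_nsmul_val_le_roots {R : Type*} [CommRing R] [IsDomain R] {p : R[X]} (hp : p ≠ 0)
    {s : Finset R} (hs : ∀ a ∈ s, p.IsRoot a ∧ (derivative p).IsRoot a) :
    2 • s.val ≤ p.roots := by
  classical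
  refine Multiset.le_iff_count.2 fun a => ?_
  rw [Multiset.count_nsmul, Multiset.count_eq_of_nodup s.nodup, count_roots]
  split_ifs with ha
  · exact (one_lt_rootMultiplicity_iff_isRoot hp).2 (hs a ha)
  · exact Nat.zero_le _

theorem iterate_derivative_eq_C_of_natDegree_le {R : Type*} [Semiring R] {p : R[X]} {k : ℕ}
    (hp : p.natDegree ≤ k) : derivative^[k] p = C (k.factorial * p.coeff k) := by
  have hdeg : (derivative^[k] p).natDegree ≤ 0 := by
    have := natDegree_iterate_derivative p k
    omega
  rw [eq_C_of_natDegree_le_zero hdeg, coeff_iterate_derivative, zero_add, Nat.descFactorial_self,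
    nsmul_eq_mul]

theorem exists_hermite_interpolant_of_isRoot {K : Type*} [Field K] [DecidableEq K] {s : Finset K}
    (hs : s.Nonempty) (d : K → K) :
    ∃ Q : K[X], Q.natDegree ≤ 2 * s.card - 1 ∧
      Q.coeff (2 * s.card - 1) = ∑ a ∈ s, d a / (∏ b ∈ s.erase a, (a - b)) ^ 2 ∧
      ∀ a ∈ s, Q.IsRoot a ∧ (derivative Q).eval a = d a := by
  set ω := Lagrange.nodal s id
  set q := Lagrange.interpolate s id fun a => d a / ∏ b ∈ s.erase a, (a - b)
  have hcard := hs.card_pos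
  have hω (a) (ha : a ∈ s) : ω.eval a = 0 := Lagrange.eval_nodal_at_node (v := id) ha
  have hω' (a) (ha : a ∈ s) : (derivative ω).eval a = ∏ b ∈ s.erase a, (a - b) := by
    simpa only [id, Lagrange.eval_nodal] using
      Lagrange.eval_nodal_derivative_eval_node_eq (v := id) ha
  have hprod (a : K) : ∏ b ∈ s.erase a, (a - b) ≠ 0 :=
    Finset.prod_ne_zero_iff.2 fun b hb => sub_ne_zero.2 (Finset.ne_of_mem_erase hb).symm
  have hq (a) (ha : a ∈ s) : q.eval a = d a / ∏ b ∈ s.erase a, (a - b) :=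
    Lagrange.eval_interpolate_at_node (v := id) _ Function.injective_id.injOn ha
  have hdegω : ω.natDegree = s.card := Lagrange.natDegree_nodal
  have hdegq : q.degree < s.card := Lagrange.degree_interpolate_lt _ Function.injective_id.injOn
  have hdegq' : q.natDegree ≤ s.card - 1 := natDegree_le_pred (natDegree_le_of_degree_le hdegq.le)
    (coeff_eq_zero_of_degree_lt hdegq)
  have hindex : 2 * s.card - 1 = s.card + (s.card - 1) := by omega
  refine ⟨ω * q, ?_, ?_, fun a ha => ⟨?_, ?_⟩⟩
  · exact natDegree_mul_le.trans (by omega)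
  · rw [hindex, coeff_mul_add_eq_of_natDegree_le hdegω.le hdegq', ← hdegω,
      (Lagrange.nodal_monic (v := id)).coeff_natDegree, one_mul, hdegω,
      Lagrange.coeff_eq_sum (v := id) Function.injective_id.injOn hdegq]
    refine Finset.sum_congr rfl fun a ha => ?_
    rw [id, hq a ha, div_div, sq]
    rfl
  · rw [IsRoot, eval_mul, hω a ha, zero_mul]
  · rw [derivative_mul, eval_add, eval_mul, eval_mul, hω a ha, zero_mul, add_zero, hω' a ha,
      hq a ha, mul_div_cancel₀ _ (hprod a)]

/- `p` minus its Hermite interpolant has a double root at each node, so Rolle's theorem applies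
`2 * #s - 1` times. -/
theorem exists_eval_iterate_derivative_eq_sum_of_isRoot {s : Finset ℝ} (hs : s.Nonempty) {p : ℝ[X]}
    (hp : ∀ a ∈ s, p.IsRoot a) :
    ∃ x, (derivative^[2 * s.card - 1] p).eval x = (2 * s.card - 1).factorial *
      ∑ a ∈ s, (derivative p).eval a / (∏ b ∈ s.erase a, (a - b)) ^ 2 := by
  obtain ⟨Q, hdeg, hcoeff, hQ⟩ :=
    exists_hermite_interpolant_of_isRoot hs fun a => (derivative p).eval a
  obtain ⟨x, hx⟩ : ∃ x, (derivative^[2 * s.card - 1] (p - Q)).IsRoot x := by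
    by_cases h0 : p - Q = 0
    · exact ⟨0, by rw [h0, iterate_derivative_zero]; exact eval_zero⟩
    have hdouble : 2 • s.val ≤ (p - Q).roots := two_nsmul_val_le_roots h0 fun a ha => by
      simp [(hp a ha).eq_zero, (hQ a ha).1.eq_zero, (hQ a ha).2]
    have hcard := Multiset.card_le_card hdouble
    rw [Multiset.card_nsmul, Finset.card_val] at hcard
    have := hs.card_pos
    exact exists_isRoot_iterate_derivative_of_lt_card_roots _ (by omega)
  refine ⟨x, ?_⟩
  rwa [IsRoot, iterate_derivative_sub, eval_sub, sub_eq_zero,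
    iterate_derivative_eq_C_of_natDegree_le hdeg, eval_C, hcoeff] at hx

theorem sum_eval_derivative_mul_sq_nonneg {p : ℝ[X]} (hp : ∀ x, 0 ≤ (derivative^[5] p).eval x)
    {a b c : ℝ} (hab : a ≠ b) (hac : a ≠ c) (hbc : b ≠ c) (ha : p.IsRoot a) (hb : p.IsRoot b)
    (hc : p.IsRoot c) :
    0 ≤ (derivative p).eval a * (c - b) ^ 2 + (derivative p).eval b * (c - a) ^ 2 +
      (derivative p).eval c * (b - a) ^ 2 := by
  have hcard : ({a, b, c} : Finset ℝ).card = 3 :=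
    Finset.card_eq_three.2 ⟨a, b, c, hab, hac, hbc, rfl⟩
  have hea : ({a, b, c} : Finset ℝ).erase a = {b, c} := by grind
  have heb : ({a, b, c} : Finset ℝ).erase b = {a, c} := by grind
  have hec : ({a, b, c} : Finset ℝ).erase c = {a, b} := by grind
  obtain ⟨x, hx⟩ := exists_eval_iterate_derivative_eq_sum_of_isRoot (s := {a, b, c}) (p := p)
    (by simp) (by simpa using ⟨ha, hb, hc⟩)
  have hsum := hp x
  rw [hcard] at hx
  rw [hx, mul_nonneg_iff_of_pos_left (by positivity), Finset.sum_insert (by simp [hab, hac]),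
    Finset.sum_pair hbc, hea, heb, hec, Finset.prod_pair hbc, Finset.prod_pair hac,
    Finset.prod_pair hab] at hsum
  have := sub_ne_zero.2 hab
  have := sub_ne_zero.2 hac
  have := sub_ne_zero.2 hbc
  have := sub_ne_zero.2 hab.symm
  have := sub_ne_zero.2 hac.symm
  have := sub_ne_zero.2 hbc.symm
  calc 0 ≤ _ := mul_nonneg hsum (sq_nonneg ((a - b) * (a - c) * (b - c)))
    _ = _ := by field_simp; ring

section PowVersusAffine

variable {N : ℕ} {μ c a b d : ℝ}

theorem sum_deriv_mul_sq_nonneg_of_odd_pow_eq (hN : Odd N) (hab : a ≠ b) (had : a ≠ d)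
    (hbd : b ≠ d) (ha : a ^ N = μ * a + c) (hb : b ^ N = μ * b + c) (hd : d ^ N = μ * d + c) :
    0 ≤ (N * a ^ (N - 1) - μ) * (d - b) ^ 2 + (N * b ^ (N - 1) - μ) * (d - a) ^ 2 +
      (N * d ^ (N - 1) - μ) * (b - a) ^ 2 := by
  have hderiv (x : ℝ) : (derivative (X ^ N - C μ * X - C c)).eval x = N * x ^ (N - 1) - μ := by
    simp [derivative_X_pow]
  have hroot {x : ℝ} (hx : x ^ N = μ * x + c) : (X ^ N - C μ * X - C c).IsRoot x := by
    simp [hx]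
  have hfifth (x : ℝ) : 0 ≤ (derivative^[5] (X ^ N - C μ * X - C c)).eval x := by
    have hlin : derivative^[5] (C μ * X : ℝ[X]) = 0 := by
      rw [iterate_derivative_C_mul, iterate_derivative_X (by norm_num), mul_zero]
    rw [iterate_derivative_sub, iterate_derivative_sub, hlin, iterate_derivative_C (by norm_num),
      iterate_derivative_X_pow_eq_natCast_mul, sub_zero, sub_zero, eval_mul, eval_natCast,
      eval_pow, eval_X]
    rcases lt_or_ge N 5 with h | -
    · rw [Nat.descFactorial_of_lt h, Nat.cast_zero, zero_mul]
    · exact mul_nonneg (Nat.cast_nonneg _) ((Nat.Odd.sub_odd hN (by decide)).pow_nonneg x)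
  simpa only [hderiv] using
    sum_eval_derivative_mul_sq_nonneg hfifth hab had hbd (hroot ha) (hroot hb) (hroot hd)

theorem ne_affine_of_strictConvexOn {f : ℝ → ℝ} (hf : StrictConvexOn ℝ Set.univ f) (hab : a ≠ b)
    (had : a ≠ d) (hbd : b ≠ d) (ha : f a = μ * a + c) (hb : f b = μ * b + c) :
    f d ≠ μ * d + c := by
  have ordered {x y z : ℝ} (hxy : x < y) (hyz : y < z) (hx : f x = μ * x + c)
      (hy : f y = μ * y + c) (hz : f z = μ * z + c) : False := by
    have hslope := hf.slope_strict_mono_adjacent (Set.mem_univ x) (Set.mem_univ z) hxy hyz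
    rw [div_lt_div_iff₀ (sub_pos.2 hxy) (sub_pos.2 hyz), hx, hy, hz] at hslope
    linarith
  intro hd
  rcases lt_or_gt_of_ne hab with h1 | h1 <;> rcases lt_or_gt_of_ne had with h2 | h2 <;>
    rcases lt_or_gt_of_ne hbd with h3 | h3 <;> grind

theorem quasiconvexOn_pow (k : ℕ) : QuasiconvexOn ℝ Set.univ fun x : ℝ => x ^ k := by
  rcases k.even_or_odd with hk | hk
  · exact hk.convexOn_pow.quasiconvexOn
  · exact hk.strictMono_pow.monotone.quasiconvexOn

theorem slope_le_max_of_pow_eq (hab : a ≠ b) (ha : a ^ N = μ * a + c)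
    (hb : b ^ N = μ * b + c) : μ ≤ max (N * a ^ (N - 1)) (N * b ^ (N - 1)) := by
  wlog hlt : a < b generalizing a b
  · rw [max_comm]
    exact this hab.symm hb ha (lt_of_le_of_ne (not_lt.1 hlt) hab.symm)
  obtain ⟨ξ, hξ, hslope⟩ := exists_hasDerivAt_eq_slope (fun t : ℝ => t ^ N)
    (fun t => N * t ^ (N - 1)) hlt (by fun_prop) (fun t _ => by simpa using hasDerivAt_pow N t)
  have hμ : N * ξ ^ (N - 1) = μ := by
    rw [hslope, ha, hb, div_eq_iff (sub_pos.2 hlt).ne']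
    ring
  have hmax : ξ ^ (N - 1) ≤ max (a ^ (N - 1)) (b ^ (N - 1)) :=
    ((quasiconvexOn_pow (N - 1) _).ordConnected.out ⟨Set.mem_univ a, le_max_left _ _⟩
      ⟨Set.mem_univ b, le_max_right _ _⟩ (Set.Ioo_subset_Icc_self hξ)).2
  rw [← mul_max_of_nonneg _ _ N.cast_nonneg, ← hμ]
  exact mul_le_mul_of_nonneg_left hmax N.cast_nonneg

end PowVersusAffine

section SecondOrder

/-- Strict second-order condition at a critical point `x` of `∑ φ(xᵢ)` with `∑ xᵢ` and `∑ xᵢ²`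
fixed: the Hessian, diagonal with entries `dᵢ`, is negative definite on the tangent space, the
orthogonal complement of the all-ones vector and `x`. -/
def IsNegDefOnTangent {ι : Type*} [Fintype ι] (d x : ι → ℝ) : Prop :=
  ∀ y : ι → ℝ, y ≠ 0 → ∑ i, y i = 0 → ∑ i, x i * y i = 0 → ∑ i, d i * y i ^ 2 < 0

theorem sum_eq_add_add_of_forall_ne {ι M : Type*} [Fintype ι] [AddCommMonoid M] {i j k : ι}
    (hij : i ≠ j) (hik : i ≠ k) (hjk : j ≠ k) {f : ι → M}
    (hf : ∀ l, l ≠ i → l ≠ j → l ≠ k → f l = 0) : ∑ l, f l = f i + f j + f k := by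
  classical
  rw [← Finset.sum_subset (Finset.subset_univ {i, j, k}) fun l _ hl => ?_,
    Finset.sum_insert (by simp [hij, hik]), Finset.sum_pair hjk, add_assoc]
  simp only [Finset.mem_insert, Finset.mem_singleton, not_or] at hl
  exact hf l hl.1 hl.2.1 hl.2.2

namespace IsNegDefOnTangent

variable {ι : Type*} [Fintype ι] {d x : ι → ℝ} {N : ℕ} {μ c : ℝ} {i j k : ι}

theorem add_neg_of_eq (h : IsNegDefOnTangent d x) (hij : i ≠ j) (hx : x i = x j) :
    d i + d j < 0 := by
  classical
  have hsum {g : ι → ℝ} : ∑ l, g l * (Pi.single i 1 - Pi.single j 1 : ι → ℝ) l = g i - g j := by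
    simp [mul_sub, Pi.single_apply]
  have hy := h (Pi.single i 1 - Pi.single j 1) ?_ ?_ ?_
  · rw [Fintype.sum_eq_add i j hij fun l hl => ?_] at hy
    · simpa [hij, hij.symm] using hy
    · simp [hl.1, hl.2]
  · exact fun h0 => by have := congrFun h0 i; simp [hij] at this
  · simp
  · rw [hsum, hx, sub_self]

/- The test vector is the cross product of `(1, 1, 1)` and `(x i, x j, x k)`. -/
theorem sum_mul_sq_neg_of_ne (h : IsNegDefOnTangent d x) (hij : x i ≠ x j) (hik : x i ≠ x k)
    (hjk : x j ≠ x k) :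
    d i * (x k - x j) ^ 2 + d j * (x k - x i) ^ 2 + d k * (x j - x i) ^ 2 < 0 := by
  classical
  have hij' : i ≠ j := ne_of_apply_ne x hij
  have hik' : i ≠ k := ne_of_apply_ne x hik
  have hjk' : j ≠ k := ne_of_apply_ne x hjk
  set y : ι → ℝ := Pi.single i (x k - x j) + Pi.single j (x i - x k) + Pi.single k (x j - x i)
  have hyi : y i = x k - x j := by simp [y, hij', hik']
  have hyj : y j = x i - x k := by simp [y, hij'.symm, hjk']
  have hyk : y k = x j - x i := by simp [y, hik'.symm, hjk'.symm]
  have hy0 (l) (hi : l ≠ i) (hj : l ≠ j) (hk : l ≠ k) : y l = 0 := by simp [y, hi, hj, hk]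
  have hy := h y ?_ ?_ ?_
  · rw [sum_eq_add_add_of_forall_ne hij' hik' hjk'
      fun l hi hj hk => by rw [hy0 l hi hj hk, sq, zero_mul, mul_zero], hyi, hyj, hyk] at hy
    linarith
  · exact fun h0 => hjk (sub_eq_zero.1 (hyi.symm.trans (congrFun h0 i))).symm
  · rw [sum_eq_add_add_of_forall_ne hij' hik' hjk' hy0, hyi, hyj, hyk]
    ring
  · rw [sum_eq_add_add_of_forall_ne hij' hik' hjk'
      fun l hi hj hk => by rw [hy0 l hi hj hk, mul_zero], hyi, hyj, hyk]
    ring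

theorem eq_or_eq_or_eq (h : IsNegDefOnTangent (fun l => N * x l ^ (N - 1) - μ) x)
    (hx : ∀ l, x l ^ N = μ * x l + c) (hN : N ≠ 0) (i j k : ι) :
    x i = x j ∨ x i = x k ∨ x j = x k := by
  by_contra! hne
  obtain ⟨hij, hik, hjk⟩ := hne
  rcases N.even_or_odd with he | ho
  · exact ne_affine_of_strictConvexOn (he.strictConvexOn_pow hN) hij hik hjk (hx i) (hx j) (hx k)
  · exact (sum_deriv_mul_sq_nonneg_of_odd_pow_eq ho hij hik hjk (hx i) (hx j) (hx k)).not_gt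
      (h.sum_mul_sq_neg_of_ne hij hik hjk)

theorem deriv_lt_of_eq (h : IsNegDefOnTangent (fun l => N * x l ^ (N - 1) - μ) x) (hij : i ≠ j)
    (hx : x i = x j) : N * x i ^ (N - 1) < μ := by
  have := h.add_neg_of_eq hij hx
  simp only [← hx] at this
  linarith

/- If two distinct values were each attained twice, the derivative of `t ^ N` would be less than
`μ` at both, although `μ` is the slope of the chord between them. -/
theorem exists_forall_ne_eq [Nonempty ι]
    (h : IsNegDefOnTangent (fun l => N * x l ^ (N - 1) - μ) x)
    (hx : ∀ l, x l ^ N = μ * x l + c) (hN : N ≠ 0) :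
    ∃ j a, ∀ i ≠ j, x i = a := by
  by_contra! hcon
  obtain ⟨i₀⟩ := ‹Nonempty ι›
  obtain ⟨i₁, -, hval⟩ := hcon i₀ (x i₀)
  obtain ⟨i₂, hi₂, hval₂⟩ := hcon i₀ (x i₁)
  obtain ⟨i₃, hi₃, hval₃⟩ := hcon i₁ (x i₀)
  have h₂ : x i₀ = x i₂ := by have := h.eq_or_eq_or_eq hx hN i₀ i₁ i₂; grind
  have h₃ : x i₁ = x i₃ := by have := h.eq_or_eq_or_eq hx hN i₀ i₁ i₃; grind
  have hlt := max_lt (h.deriv_lt_of_eq hi₃.symm h₃) (h.deriv_lt_of_eq hi₂.symm h₂)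
  exact hlt.not_ge (slope_le_max_of_pow_eq hval (hx i₁) (hx i₀))

end IsNegDefOnTangent

end SecondOrder

section Matrices

theorem eq_one_of_isIdempotentElem_of_trace_eq_card {ι K : Type*} [Fintype ι] [DecidableEq ι]
    [Field K] [CharZero K] {P : Matrix ι ι K} (hP : IsIdempotentElem P)
    (htrace : P.trace = Fintype.card ι) : P = 1 := by
  have hidem : IsIdempotentElem (toLin' (1 - P)) := by
    rw [IsIdempotentElem, Module.End.mul_eq_comp, ← toLin'_mul, hP.one_sub]
  have hzero : toLin' (1 - P) = 0 :=
    (LinearMap.IsIdempotentElem.trace_eq_zero_iff hidem).1 (by simp [htrace])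
  exact (sub_eq_zero.1 (toLin'.map_eq_zero_iff.1 hzero)).symm

theorem charpoly_smul_one_sub_vecMulVec_self {ι R : Type*} [Fintype ι] [DecidableEq ι] [Nonempty ι]
    [CommRing R] (θ : R) {u : ι → R} (hu : u ⬝ᵥ u = 1) :
    (θ • (1 - vecMulVec u u)).charpoly = X * (X - C θ) ^ (Fintype.card ι - 1) := by
  have h : θ • (1 - vecMulVec u u) = vecMulVec (-θ • u) u - scalar ι (-θ) := by
    rw [smul_sub, smul_vecMulVec, map_neg, scalar_apply, ← Matrix.smul_one_eq_diagonal, neg_smul]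
    abel
  obtain ⟨k, hk⟩ := Nat.exists_eq_succ_of_ne_zero (Fintype.card_ne_zero (α := ι))
  rw [h, charpoly_sub_scalar, charpoly_vecMulVec, smul_dotProduct, hu, hk]
  simp only [Nat.succ_eq_add_one, Nat.add_sub_cancel, pow_succ, smul_eq_mul, mul_one, neg_smul,
    smul_eq_C_mul, sub_neg_eq_add, map_neg, add_comp, mul_comp, pow_comp, X_comp, C_comp]
  ring

variable {n : ℕ} {A : Matrix (Fin n) (Fin n) ℝ}

theorem ofReal_mem_spectrum_map {μ : ℝ} (h : μ ∈ spectrum ℝ A) :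
    (μ : ℂ) ∈ spectrum ℂ (A.map (fun x : ℝ => (x : ℂ))) := by
  rw [mem_spectrum_iff_isRoot_charpoly] at h ⊢
  exact A.charpoly_map Complex.ofRealHom ▸ h.map (f := Complex.ofRealHom)

theorem nnnorm_le_matrixSpectralRadius {μ : ℝ} (h : μ ∈ spectrum ℝ A) :
    ‖μ‖₊ ≤ matrixSpectralRadius A := by
  rw [← Complex.nnnorm_real]
  exact le_iSup₂ (α := ENNReal) (f := fun (z : ℂ) (_ : z ∈ spectrum ℂ _) => (‖z‖₊ : ENNReal)) _
    (ofReal_mem_spectrum_map h)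

theorem matrixSpectralRadius_eq_spectralRadius_of_splits (hA : A.charpoly.Splits) :
    matrixSpectralRadius A = spectralRadius ℝ A := by
  refine le_antisymm (iSup₂_le fun z hz => ?_) (iSup₂_le fun μ => nnnorm_le_matrixSpectralRadius)
  rw [mem_spectrum_iff_isRoot_charpoly] at hz
  have hz' : (A.charpoly.map Complex.ofRealHom).IsRoot z :=
    A.charpoly_map Complex.ofRealHom ▸ hz
  obtain ⟨μ, rfl⟩ := hA.mem_range_of_isRoot A.charpoly_monic.ne_zero hz'
  have hμ : μ ∈ spectrum ℝ A := mem_spectrum_iff_isRoot_charpoly.2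
    (hz'.of_map (f := Complex.ofRealHom) Complex.ofRealHom.injective)
  rw [Complex.ofRealHom_eq_coe, Complex.nnnorm_real]
  exact le_iSup₂ (α := ENNReal) (f := fun (μ : ℝ) (_ : μ ∈ spectrum ℝ A) => (‖μ‖₊ : ENNReal)) μ hμ

theorem matrixSpectralRadius_smul_one_sub_vecMulVec_self (hn : 2 ≤ n) (θ : ℝ) {u : Fin n → ℝ}
    (hu : u ⬝ᵥ u = 1) :
    matrixSpectralRadius (θ • (1 - vecMulVec u u)) = ENNReal.ofReal |θ| := by
  have : NeZero n := ⟨by omega⟩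
  have hcharpoly := charpoly_smul_one_sub_vecMulVec_self θ hu
  have hsplits : (θ • (1 - vecMulVec u u)).charpoly.Splits := by
    rw [hcharpoly]
    exact Splits.X.mul ((Splits.X_sub_C θ).pow _)
  have hspectrum : spectrum ℝ (θ • (1 - vecMulVec u u)) = {0, θ} := by
    ext μ
    have hn1 : n - 1 ≠ 0 := by omega
    rw [mem_spectrum_iff_isRoot_charpoly, hcharpoly]
    simp [hn1, sub_eq_zero]
  rw [matrixSpectralRadius_eq_spectralRadius_of_splits hsplits, spectralRadius, hspectrum,
    iSup_insert, iSup_singleton, nnnorm_zero, ENNReal.coe_zero, max_eq_right zero_le,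
    ← Real.enorm_eq_ofReal_abs, enorm_eq_nnnorm]

theorem posDef_one_sub_of_matrixSpectralRadius_lt_one (hA : A.IsSymm)
    (h : matrixSpectralRadius A < 1) : (1 - A).PosDef := by
  have hH : (1 - A).IsHermitian := isHermitian_one.sub hA
  rw [hH.posDef_iff_eigenvalues_pos]
  intro i
  set e := hH.eigenvalues i
  have hmem : 1 - e ∈ spectrum ℝ A := by
    have := Set.sub_mem_sub (Set.mem_singleton 1) (hH.eigenvalues_mem_spectrum_real i)
    rwa [spectrum.singleton_sub_eq, map_one, sub_sub_cancel] at this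
  have hlt : |1 - e| < 1 := by
    rw [← ENNReal.ofReal_lt_one, ← Real.enorm_eq_ofReal_abs]
    exact (nnnorm_le_matrixSpectralRadius hmem).trans_lt h
  linarith [(abs_lt.1 hlt).2]

end Matrices

namespace RTensor

variable {m n : ℕ}

theorem applyVec_neg (S : RTensor m n) (v : Fin n → ℝ) :
    S.applyVec (-v) = (-1 : ℝ) ^ (m - 1) • S.applyVec v := by
  ext j
  simp only [applyVec, Pi.neg_apply, Pi.smul_apply, smul_eq_mul, Finset.mul_sum,
    Finset.prod_neg, Finset.card_univ, Fintype.card_fin]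
  exact Finset.sum_congr rfl fun _ _ => mul_left_comm _ _ _

theorem applyMat_neg (S : RTensor m n) (v : Fin n → ℝ) :
    S.applyMat (-v) = (-1 : ℝ) ^ (m - 2) • S.applyMat v := by
  ext i j
  simp only [applyMat, of_apply, Pi.neg_apply, Matrix.smul_apply, smul_eq_mul, Finset.mul_sum,
    Finset.prod_neg, Finset.card_univ, Fintype.card_fin]
  exact Finset.sum_congr rfl fun _ _ => mul_left_comm _ _ _

theorem applyVec_simplexTensor (hm : 1 ≤ m) (w : Fin (n + 1) → Fin n → ℝ) (v : Fin n → ℝ) :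
    (simplexTensor m w).applyVec v = ∑ i, (w i ⬝ᵥ v) ^ (m - 1) • w i := by
  obtain ⟨k, rfl⟩ : ∃ k, m = k + 1 := ⟨m - 1, by omega⟩
  ext j
  simp only [applyVec, simplexTensor, outerPower, Finset.sum_mul, Finset.sum_apply,
    Pi.smul_apply, smul_eq_mul, dotProduct, Nat.add_sub_cancel, Fintype.sum_pow]
  rw [Finset.sum_comm]
  refine Finset.sum_congr rfl fun i _ => Finset.sum_congr rfl fun idx _ => ?_
  rw [Fin.prod_univ_succ]
  simp only [Fin.coe_ofNat_eq_mod, Nat.zero_mod, ↓reduceDIte, Fin.val_succ, Nat.add_eq_zero_iff,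
    one_ne_zero, and_false, Nat.add_one_sub_one, add_tsub_cancel_right, Fin.eta,
    Finset.prod_mul_distrib]
  ring

theorem dotProduct_applyVec_simplexTensor (hm : 1 ≤ m) (w : Fin (n + 1) → Fin n → ℝ)
    (v : Fin n → ℝ) : v ⬝ᵥ (simplexTensor m w).applyVec v = ∑ i, (w i ⬝ᵥ v) ^ m := by
  rw [applyVec_simplexTensor hm, dotProduct_comm]
  simp only [sum_dotProduct, smul_dotProduct, smul_eq_mul,
    pow_sub_one_mul (Nat.one_le_iff_ne_zero.1 hm)]

theorem applyMat_simplexTensor (hm : 2 ≤ m) (w : Fin (n + 1) → Fin n → ℝ) (v : Fin n → ℝ) :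
    (simplexTensor m w).applyMat v = ∑ i, (w i ⬝ᵥ v) ^ (m - 2) • vecMulVec (w i) (w i) := by
  obtain ⟨k, rfl⟩ : ∃ k, m = k + 2 := ⟨m - 2, by omega⟩
  ext a b
  simp only [applyMat, simplexTensor, outerPower, Finset.sum_mul, Matrix.sum_apply,
    Matrix.smul_apply, smul_eq_mul, dotProduct, Nat.add_sub_cancel, Fintype.sum_pow, of_apply,
    vecMulVec_apply]
  rw [Finset.sum_comm]
  refine Finset.sum_congr rfl fun i _ => Finset.sum_congr rfl fun (idx : Fin k → Fin n) _ => ?_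
  rw [Fin.prod_univ_succ, Fin.prod_univ_succ]
  change _ * ∏ l : Fin k, v (idx l) = _
  simp only [Fin.coe_ofNat_eq_mod, Nat.zero_mod, ↓reduceDIte, Fin.succ_zero_eq_one, Nat.one_mod,
    one_ne_zero, Fin.val_succ, Nat.add_eq_zero_iff, and_false, and_self, Nat.add_eq_right,
    Nat.reduceSubDiff, Fin.eta, Finset.prod_mul_distrib]
  ring

end RTensor

section Eigenpairs

variable {m n : ℕ} {S : RTensor m n} {ev : ℝ} {v : Fin n → ℝ}

theorem IsEigenpair.eigenvalue_eq (h : IsEigenpair S ev v) : ev = v ⬝ᵥ S.applyVec v := by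
  rw [h.1, dotProduct_smul, h.2, smul_eq_mul, mul_one]

theorem IsEigenpair.neg (hm : 1 ≤ m) (h : IsEigenpair S ev v) :
    IsEigenpair S ((-1) ^ m * ev) (-v) := by
  obtain ⟨k, rfl⟩ := Nat.exists_eq_add_of_le' hm
  refine ⟨?_, by rw [neg_dotProduct_neg, h.2]⟩
  rw [S.applyVec_neg, h.1, smul_smul, smul_neg, ← neg_smul, Nat.add_sub_cancel]
  congr 1
  ring

theorem jacobianAt_neg (hm : 2 ≤ m) (S : RTensor m n) (ev : ℝ) (v : Fin n → ℝ) :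
    jacobianAt S ((-1) ^ m * ev) (-v) = jacobianAt S ev v := by
  have hsign : (-1 : ℝ) ^ (m - 2) = (-1) ^ m := by
    obtain ⟨k, rfl⟩ := Nat.exists_eq_add_of_le' hm
    rw [Nat.add_sub_cancel, pow_add, neg_one_sq, mul_one]
  rw [jacobianAt, jacobianAt, S.applyMat_neg, hsign, neg_vecMulVec, vecMulVec_neg, neg_neg,
    mul_smul, ← smul_sub, smul_smul]
  congr 1
  rcases neg_one_pow_eq_or ℝ m with h | h <;> rw [h] <;> simp [div_neg]

theorem IsRobustEigenpair.neg (hm : 2 ≤ m) (h : IsRobustEigenpair S ev v) :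
    IsRobustEigenpair S ((-1) ^ m * ev) (-v) :=
  ⟨h.1.neg (by omega), mul_ne_zero (by simp) h.2.1, by
    rw [jacobianAt_neg hm]
    exact h.2.2⟩

theorem isSymm_jacobianAt_simplexTensor (hm : 2 ≤ m) (w : Fin (n + 1) → Fin n → ℝ) (ev : ℝ)
    (v : Fin n → ℝ) : (jacobianAt (simplexTensor m w) ev v).IsSymm := by
  simp only [IsSymm, jacobianAt, RTensor.applyMat_simplexTensor hm, transpose_smul, transpose_sub,
    transpose_sum, transpose_vecMulVec]

theorem dotProduct_jacobianAt_simplexTensor_mulVec (hm : 2 ≤ m) (w : Fin (n + 1) → Fin n → ℝ)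
    (ev : ℝ) {u v : Fin n → ℝ} (huv : v ⬝ᵥ u = 0) :
    u ⬝ᵥ jacobianAt (simplexTensor m w) ev v *ᵥ u =
      (m - 1) / ev * ∑ i, (w i ⬝ᵥ v) ^ (m - 2) * (w i ⬝ᵥ u) ^ 2 := by
  simp only [jacobianAt, RTensor.applyMat_simplexTensor hm, smul_mulVec, sub_mulVec,
    Matrix.sum_mulVec, vecMulVec_mulVec, op_smul_eq_smul, huv, zero_smul, smul_zero, sub_zero,
    dotProduct_smul, dotProduct_sum, smul_eq_mul]
  simp only [dotProduct_comm u, sq]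

theorem nonneg_of_isEigenpair_simplexTensor {w : Fin (n + 1) → Fin n → ℝ} (hm : Even m)
    (hm0 : m ≠ 0) (h : IsEigenpair (simplexTensor m w) ev v) : 0 ≤ ev := by
  rw [h.eigenvalue_eq, RTensor.dotProduct_applyVec_simplexTensor (by omega)]
  exact Finset.sum_nonneg fun i _ => hm.pow_nonneg _

end Eigenpairs

namespace IsRegularSimplexFrame

variable {n m : ℕ} {w : Fin (n + 1) → Fin n → ℝ} {ev : ℝ} {v : Fin n → ℝ}

section Frame

theorem ne_zero (hw : IsRegularSimplexFrame w) : (n : ℝ) ≠ 0 := by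
  rintro h
  obtain rfl := Nat.cast_eq_zero.1 h
  simpa using hw.1 0

theorem dotProduct_eq (hw : IsRegularSimplexFrame w) (i j : Fin (n + 1)) :
    w i ⬝ᵥ w j = (if i = j then ((n : ℝ) + 1) / n else 0) - 1 / n := by
  have := hw.ne_zero
  split_ifs with h
  · rw [h, hw.1]
    field_simp
    ring
  · rw [hw.2 i j h, zero_sub, neg_div]

theorem dotProduct_sum_smul (hw : IsRegularSimplexFrame w) (y : Fin (n + 1) → ℝ)
    (j : Fin (n + 1)) :
    w j ⬝ᵥ ∑ i, y i • w i = ((n : ℝ) + 1) / n * y j - (∑ i, y i) / n := by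
  simp only [dotProduct_sum, dotProduct_smul, hw.dotProduct_eq, smul_eq_mul, mul_sub,
    Finset.sum_sub_distrib, ← Finset.sum_mul, mul_ite, mul_zero, Finset.sum_ite_eq,
    Finset.mem_univ, if_true]
  ring

theorem sum_eq_zero (hw : IsRegularSimplexFrame w) : ∑ i, w i = 0 := by
  have horth (j) : w j ⬝ᵥ ∑ i, w i = 0 := by
    have := hw.dotProduct_sum_smul 1 j
    simp only [Pi.one_apply, one_smul, Finset.sum_const, Finset.card_univ, Fintype.card_fin] at this
    rw [this]
    simp
  rw [← dotProduct_self_eq_zero, sum_dotProduct, Finset.sum_eq_zero fun j _ => horth j]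

theorem sum_dotProduct_pow_smul {M : Type*} [AddCommGroup M] [Module ℝ M]
    (hw : IsRegularSimplexFrame w) (f : Fin (n + 1) → M) (k : ℕ) (j : Fin (n + 1)) :
    ∑ i, (w i ⬝ᵥ w j) ^ k • f i =
      (-1 / n : ℝ) ^ k • ∑ i, f i + (1 - (-1 / n : ℝ) ^ k) • f j := by
  have hterm (i) : (w i ⬝ᵥ w j) ^ k • f i =
      (-1 / n : ℝ) ^ k • f i + if i = j then (1 - (-1 / n : ℝ) ^ k) • f i else 0 := by
    split_ifs with h
    · rw [h, hw.1, one_pow, ← add_smul, add_sub_cancel]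
    · rw [hw.2 i j h, add_zero]
  simp only [hterm, Finset.sum_add_distrib, ← Finset.smul_sum, Finset.sum_ite_eq',
    Finset.mem_univ, if_true]

/- Up to the factor `(n + 1) / n`, the frame operator is an idempotent of trace `n`. -/
theorem sum_vecMulVec_self (hw : IsRegularSimplexFrame w) :
    ∑ i, vecMulVec (w i) (w i) = (((n : ℝ) + 1) / n) • (1 : Matrix (Fin n) (Fin n) ℝ) := by
  have h0 := hw.ne_zero
  have h1 : (n : ℝ) + 1 ≠ 0 := by positivity
  set T := ∑ i, vecMulVec (w i) (w i) with hT
  have hTw (j) : T *ᵥ w j = (((n : ℝ) + 1) / n) • w j := by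
    have := hw.sum_dotProduct_pow_smul w 1 j
    simp only [pow_one, hw.sum_eq_zero, smul_zero, zero_add] at this
    simp only [hT, Matrix.sum_mulVec, vecMulVec_mulVec, op_smul_eq_smul, this]
    congr 1
    field_simp
    ring
  have hTT : T * T = (((n : ℝ) + 1) / n) • T := by
    calc T * T = ∑ i, T * vecMulVec (w i) (w i) := Finset.mul_sum ..
      _ = _ := by simp only [mul_vecMulVec, hTw, smul_vecMulVec, ← Finset.smul_sum, ← hT]
  have hone : ((n : ℝ) / (n + 1)) • T = 1 := by
    refine eq_one_of_isIdempotentElem_of_trace_eq_card ?_ ?_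
    · rw [IsIdempotentElem, smul_mul_smul_comm, hTT, smul_smul]
      congr 1
      field_simp
    · simp only [hT, trace_smul, trace_sum, trace_vecMulVec, hw.1, Finset.sum_const,
        Finset.card_univ, Fintype.card_fin, nsmul_eq_mul, Nat.cast_add, Nat.cast_one, mul_one,
        smul_eq_mul]
      field_simp
  rw [← hone, smul_smul, div_mul_div_cancel₀ h0, div_self h1, one_smul]

theorem sum_dotProduct_smul (hw : IsRegularSimplexFrame w) (v : Fin n → ℝ) :
    ∑ i, (w i ⬝ᵥ v) • w i = (((n : ℝ) + 1) / n) • v := by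
  have := congrArg (· *ᵥ v) hw.sum_vecMulVec_self
  simpa only [Matrix.sum_mulVec, vecMulVec_mulVec, op_smul_eq_smul, smul_mulVec, one_mulVec]
    using this

theorem sum_dotProduct_mul_dotProduct (hw : IsRegularSimplexFrame w) (u v : Fin n → ℝ) :
    ∑ i, (w i ⬝ᵥ u) * (w i ⬝ᵥ v) = ((n : ℝ) + 1) / n * (u ⬝ᵥ v) := by
  have := congrArg (· ⬝ᵥ v) (hw.sum_dotProduct_smul u)
  simpa only [sum_dotProduct, smul_dotProduct, smul_eq_mul] using this

theorem exists_eq_smul_of_forall_ne (hw : IsRegularSimplexFrame w) {j : Fin (n + 1)} {a : ℝ}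
    (h : ∀ i ≠ j, w i ⬝ᵥ v = a) : ∃ t : ℝ, v = t • w j := by
  have h0 := hw.ne_zero
  have h1 : (n : ℝ) + 1 ≠ 0 := by positivity
  have hsum : ∑ i, (w i ⬝ᵥ v - a) • w i = (w j ⬝ᵥ v - a) • w j :=
    Fintype.sum_eq_single j fun i hi => by rw [h i hi, sub_self, zero_smul]
  simp only [sub_smul, Finset.sum_sub_distrib, ← Finset.smul_sum, hw.sum_eq_zero, smul_zero,
    sub_zero, hw.sum_dotProduct_smul] at hsum
  rw [← sub_smul] at hsum
  refine ⟨n / (n + 1) * (w j ⬝ᵥ v - a), ?_⟩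
  rw [mul_smul, ← hsum, smul_smul, div_mul_div_cancel₀ h1, div_self h0, one_smul]

end Frame

section Critical

/- Since `∑ i, w i = 0`, the `j`-th coordinate of `S v ^ (m - 1) = ev v` in the frame determines
`(w j ⬝ᵥ v) ^ (m - 1)` up to the mean of these powers. -/
theorem exists_dotProduct_pow_eq (hw : IsRegularSimplexFrame w) (hm : 1 ≤ m)
    (h : IsEigenpair (simplexTensor m w) ev v) :
    ∃ c, ∀ i, (w i ⬝ᵥ v) ^ (m - 1) = ev * n / (n + 1) * (w i ⬝ᵥ v) + c := by
  have h0 := hw.ne_zero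
  have h1 : (n : ℝ) + 1 ≠ 0 := by positivity
  refine ⟨(∑ i, (w i ⬝ᵥ v) ^ (m - 1)) / (n + 1), fun j => ?_⟩
  have hj := hw.dotProduct_sum_smul (fun i => (w i ⬝ᵥ v) ^ (m - 1)) j
  rw [← RTensor.applyVec_simplexTensor hm, h.1, dotProduct_smul, smul_eq_mul] at hj
  field_simp at hj ⊢
  linear_combination -hj

theorem isNegDefOnTangent (hw : IsRegularSimplexFrame w) (hm : 2 ≤ m) (hev : 0 < ev)
    (h : IsRobustEigenpair (simplexTensor m w) ev v) :
    IsNegDefOnTangent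
      (fun i => ((m - 1 : ℕ) : ℝ) * (w i ⬝ᵥ v) ^ (m - 1 - 1) - ev * n / (n + 1))
      (fun i => w i ⬝ᵥ v) := by
  intro y hy0 hy hxy
  have h0 := hw.ne_zero
  have h1 : (n : ℝ) + 1 ≠ 0 := by positivity
  set u : Fin n → ℝ := ((n : ℝ) / (n + 1)) • ∑ i, y i • w i with hu
  have hwu (j) : w j ⬝ᵥ u = y j := by
    rw [hu, dotProduct_smul, hw.dotProduct_sum_smul, hy, smul_eq_mul]
    field_simp
    ring
  have hu0 : u ≠ 0 := fun h => hy0 (funext fun j => by rw [← hwu, h, dotProduct_zero]; rfl)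
  have hvu : v ⬝ᵥ u = 0 := by
    have := hw.sum_dotProduct_mul_dotProduct v u
    simp only [hwu, hxy] at this
    exact (mul_eq_zero.1 this.symm).resolve_left (by positivity)
  have huu : u ⬝ᵥ u = n / (n + 1) * ∑ i, y i ^ 2 := by
    have := hw.sum_dotProduct_mul_dotProduct u u
    simp only [hwu, ← sq] at this
    rw [this]
    field_simp
  have hposDef := posDef_one_sub_of_matrixSpectralRadius_lt_one
    (isSymm_jacobianAt_simplexTensor hm w ev v) h.2.2
  have hpos := hposDef.dotProduct_mulVec_pos hu0
  rw [star_trivial, sub_mulVec, one_mulVec, dotProduct_sub,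
    dotProduct_jacobianAt_simplexTensor_mulVec hm w ev hvu, huu, sub_pos, div_mul_eq_mul_div,
    div_lt_iff₀ hev] at hpos
  simp only [hwu] at hpos
  simp only [sub_mul, Finset.sum_sub_distrib, mul_assoc, ← Finset.mul_sum]
  rw [Nat.cast_sub (by omega), Nat.cast_one, Nat.sub_sub, sub_neg]
  exact hpos.trans_eq (by ring)

theorem eq_or_eq_neg_of_isRobustEigenpair_of_pos (hw : IsRegularSimplexFrame w) (hm : 2 ≤ m)
    (hev : 0 < ev) (h : IsRobustEigenpair (simplexTensor m w) ev v) :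
    ∃ j, v = w j ∨ v = -w j := by
  obtain ⟨c, hc⟩ := hw.exists_dotProduct_pow_eq (by omega) h.1
  obtain ⟨j, a, hja⟩ := (hw.isNegDefOnTangent hm hev h).exists_forall_ne_eq hc (by omega)
  obtain ⟨t, rfl⟩ := hw.exists_eq_smul_of_forall_ne hja
  have ht : t * t = 1 := by
    simpa only [smul_dotProduct, dotProduct_smul, hw.1, smul_eq_mul, mul_one] using h.1.2
  refine ⟨j, (mul_self_eq_one_iff.1 ht).imp ?_ ?_⟩ <;> rintro rfl
  · rw [one_smul]
  · rw [neg_one_smul]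

theorem eq_or_eq_neg_of_isRobustEigenpair (hw : IsRegularSimplexFrame w) (hm : 2 ≤ m)
    (h : IsRobustEigenpair (simplexTensor m w) ev v) : ∃ j, v = w j ∨ v = -w j := by
  rcases lt_or_gt_of_ne h.2.1 with hev | hev
  · have hodd : Odd m := by
      by_contra hodd
      have heven := Nat.not_odd_iff_even.1 hodd
      exact hev.not_ge (nonneg_of_isEigenpair_simplexTensor heven (by omega) h.1)
    have hpos : 0 < (-1) ^ m * ev := by rw [hodd.neg_one_pow]; linarith
    obtain ⟨j, hj⟩ := hw.eq_or_eq_neg_of_isRobustEigenpair_of_pos hm hpos (h.neg hm)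
    rw [neg_eq_iff_eq_neg, neg_inj] at hj
    exact ⟨j, hj.symm⟩
  · exact hw.eq_or_eq_neg_of_isRobustEigenpair_of_pos hm hev h

end Critical

end IsRegularSimplexFrame

section FrameValues

variable {n m k : ℕ}

theorem add_one_mul_add_one_lt_pow (hn : 2 ≤ n) (hk : 4 ≤ k) : (n + 1) * k + 1 < n ^ k := by
  induction k, hk using Nat.le_induction with
  | base =>
    have : 8 * n ≤ n ^ 4 := by
      calc 8 * n = 2 ^ 3 * n := by norm_num
        _ ≤ n ^ 3 * n := by gcongr
        _ = n ^ 4 := by ring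
    omega
  | succ k hk ih =>
    have hpow : 2 * n ^ k ≤ n ^ (k + 1) := by
      rw [pow_succ, mul_comm]
      gcongr
    have hlin : n + 1 ≤ (n + 1) * k := Nat.le_mul_of_pos_right _ (by omega)
    rw [mul_add, mul_one]
    omega

theorem add_one_mul_add_one_lt_pow_iff_of_even (hn : 2 ≤ n) (hk : Even k) (hk0 : k ≠ 0) :
    (n + 1) * k + 1 < n ^ k ↔ 6 ≤ n + k := by
  rcases Nat.lt_or_ge k 4 with h | h
  · obtain rfl : k = 2 := by grind
    constructor
    · intro hlt
      by_contra! hsmall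
      have : n < 4 := by omega
      interval_cases n <;> omega
    · intro hlarge
      have : 4 * n ≤ n ^ 2 := by
        rw [sq]
        gcongr
        omega
      omega
  · exact iff_of_true (add_one_mul_add_one_lt_pow hn h) (by omega)

theorem add_one_mul_lt_pow_add_one_iff_of_odd (hn : 2 ≤ n) (hk : Odd k) (hk1 : k ≠ 1) :
    (n + 1) * k < n ^ k + 1 ↔ 6 ≤ n + k := by
  rcases Nat.lt_or_ge k 4 with h | h
  · obtain rfl : k = 3 := by grind
    constructor
    · intro hlt
      by_contra! hsmall
      obtain rfl : n = 2 := by omega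
      omega
    · intro hlarge
      have : 9 * n ≤ n ^ 3 := by
        calc 9 * n = 3 ^ 2 * n := by norm_num
          _ ≤ n ^ 2 * n := by gcongr; omega
          _ = n ^ 3 := by ring
      omega
  · have := add_one_mul_add_one_lt_pow hn h
    exact iff_of_true (by omega) (by omega)

/-- The eigenvalue of the regular simplex tensor of order `m` in dimension `n` at a vector of its
frame. -/
noncomputable def simplexEigenvalue (n m : ℕ) : ℝ :=
  1 + (n : ℝ) / (-(n : ℝ)) ^ m

/-- The nonzero eigenvalue, of multiplicity `n - 1`, of the Jacobian of the regular simplex tensor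
of order `m` in dimension `n` at a vector of its frame. -/
noncomputable def simplexJacobianEigenvalue (n m : ℕ) : ℝ :=
  ((n : ℝ) + 1) * ((m : ℝ) - 1) / (1 + (-(n : ℝ)) ^ (m - 2) * (n : ℝ))

theorem simplexEigenvalue_eq_one_sub_pow (hn : n ≠ 0) (hm : 1 ≤ m) :
    simplexEigenvalue n m = 1 - (-1 / n : ℝ) ^ (m - 1) := by
  obtain ⟨k, rfl⟩ := Nat.exists_eq_add_of_le' hm
  have hinv : (-1 / n : ℝ) = (-(n : ℝ))⁻¹ := by rw [neg_div, one_div, inv_neg]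
  have hpow : (-(n : ℝ)) ^ k ≠ 0 := pow_ne_zero _ (neg_ne_zero.2 (Nat.cast_ne_zero.2 hn))
  rw [simplexEigenvalue, hinv, Nat.add_sub_cancel, inv_pow, pow_succ]
  field_simp
  ring

theorem simplexEigenvalue_pos (hn : 2 ≤ n) (hm : 2 ≤ m) : 0 < simplexEigenvalue n m := by
  have hn' : (1 : ℝ) < n := by exact_mod_cast hn
  have habs : |(-1 / n : ℝ) ^ (m - 1)| < 1 := by
    rw [abs_pow, abs_div, abs_neg, abs_one, Nat.abs_cast]
    exact pow_lt_one₀ (by positivity) ((div_lt_one (by positivity)).2 hn') (by omega)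
  rw [simplexEigenvalue_eq_one_sub_pow (by omega) (by omega)]
  linarith [(abs_lt.1 habs).2]

theorem simplexJacobianEigenvalue_eq_div_simplexEigenvalue (hn : n ≠ 0) (hm : 2 ≤ m) :
    simplexJacobianEigenvalue n m =
      (m - 1) / simplexEigenvalue n m * ((n + 1) / n * (-1 / n : ℝ) ^ (m - 2)) := by
  obtain ⟨k, rfl⟩ := Nat.exists_eq_add_of_le' hm
  have hn0 : (n : ℝ) ≠ 0 := Nat.cast_ne_zero.2 hn
  have hinv : (-1 / n : ℝ) = (-(n : ℝ))⁻¹ := by rw [neg_div, one_div, inv_neg]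
  have hpow : (-(n : ℝ)) ^ k ≠ 0 := pow_ne_zero _ (neg_ne_zero.2 hn0)
  have hev : simplexEigenvalue n (k + 2) = (1 + (-n : ℝ) ^ k * n) / ((-n : ℝ) ^ k * n) := by
    rw [simplexEigenvalue, pow_add, neg_sq]
    field_simp
    ring
  rw [hev, simplexJacobianEigenvalue, hinv, Nat.add_sub_cancel, inv_pow, div_div_eq_mul_div]
  field_simp

theorem abs_simplexJacobianEigenvalue_of_odd (hn : 2 ≤ n) (hm : Odd m) (hm1 : m ≠ 1) :
    |simplexJacobianEigenvalue n m| =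
      ((n : ℝ) + 1) * ((m : ℝ) - 1) / ((n : ℝ) ^ (m - 1) - 1) := by
  have hm3 : 3 ≤ m := by grind
  obtain ⟨k, rfl⟩ := Nat.exists_eq_add_of_le' (show 2 ≤ m by omega)
  have hk : Odd k := by grind
  have hden : 1 + (-(n : ℝ)) ^ k * n = -((n : ℝ) ^ (k + 1) - 1) := by
    rw [hk.neg_pow, pow_succ]
    ring
  have hpow : 1 < (n : ℝ) ^ (k + 1) := one_lt_pow₀ (by exact_mod_cast hn) (by omega)
  have hm' : (3 : ℝ) ≤ (k + 2 : ℕ) := by exact_mod_cast hm3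
  rw [simplexJacobianEigenvalue, Nat.add_sub_cancel, hden, abs_div, abs_neg,
    abs_of_pos (sub_pos.2 hpow), abs_of_nonneg (mul_nonneg (by positivity) (by linarith))]
  rfl

theorem abs_simplexJacobianEigenvalue_of_even (hm : Even m) (hm0 : m ≠ 0) :
    |simplexJacobianEigenvalue n m| =
      ((n : ℝ) + 1) * ((m : ℝ) - 1) / (1 + (n : ℝ) ^ (m - 1)) := by
  have hm2 : 2 ≤ m := by grind
  obtain ⟨k, rfl⟩ := Nat.exists_eq_add_of_le' hm2
  have hk : Even k := by grind
  have hden : 1 + (-(n : ℝ)) ^ k * n = 1 + (n : ℝ) ^ (k + 1) := by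
    rw [hk.neg_pow, pow_succ]
  have hm' : (2 : ℝ) ≤ (k + 2 : ℕ) := by exact_mod_cast hm2
  rw [simplexJacobianEigenvalue, Nat.add_sub_cancel, hden, abs_of_nonneg]
  · rfl
  · exact div_nonneg (mul_nonneg (by positivity) (by linarith)) (by positivity)

theorem abs_simplexJacobianEigenvalue_lt_one_iff (hn : 2 ≤ n) (hm : 3 ≤ m) :
    |simplexJacobianEigenvalue n m| < 1 ↔ 7 ≤ n + m := by
  obtain ⟨k, rfl⟩ := Nat.exists_eq_add_of_le' (show 1 ≤ m by omega)
  rcases Nat.even_or_odd (k + 1) with he | ho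
  · rw [abs_simplexJacobianEigenvalue_of_even he (by omega), div_lt_one (by positivity),
      ← Nat.add_assoc, Nat.succ_le_succ_iff,
      ← add_one_mul_lt_pow_add_one_iff_of_odd hn (k := k) (by grind) (by omega),
      Nat.cast_add_one, add_sub_cancel_right, add_comm (1 : ℝ)]
    exact_mod_cast Iff.rfl
  · have hpow : 1 < (n : ℝ) ^ k := one_lt_pow₀ (by exact_mod_cast hn) (by omega)
    rw [abs_simplexJacobianEigenvalue_of_odd hn ho (by omega), Nat.add_sub_cancel,
      div_lt_one (sub_pos.2 hpow), ← Nat.add_assoc, Nat.succ_le_succ_iff,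
      ← add_one_mul_add_one_lt_pow_iff_of_even hn (k := k) (by grind) (by omega),
      Nat.cast_add_one, add_sub_cancel_right, lt_sub_iff_add_lt]
    exact_mod_cast Iff.rfl

end FrameValues

namespace IsRegularSimplexFrame

variable {n m : ℕ} {w : Fin (n + 1) → Fin n → ℝ} {ev : ℝ} {v : Fin n → ℝ}

theorem isEigenpair_frame (hw : IsRegularSimplexFrame w) (hm : 1 ≤ m) (j : Fin (n + 1)) :
    IsEigenpair (simplexTensor m w) (simplexEigenvalue n m) (w j) := by
  refine ⟨?_, hw.1 j⟩
  rw [RTensor.applyVec_simplexTensor hm, hw.sum_dotProduct_pow_smul, hw.sum_eq_zero, smul_zero,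
    zero_add, simplexEigenvalue_eq_one_sub_pow (Nat.cast_ne_zero.1 hw.ne_zero) hm]

theorem jacobianAt_frame (hw : IsRegularSimplexFrame w) (hm : 2 ≤ m) (j : Fin (n + 1)) :
    jacobianAt (simplexTensor m w) (simplexEigenvalue n m) (w j) =
      simplexJacobianEigenvalue n m • (1 - vecMulVec (w j) (w j)) := by
  have hn : n ≠ 0 := Nat.cast_ne_zero.1 hw.ne_zero
  have hcoeff : 1 - (-1 / n : ℝ) ^ (m - 2) - simplexEigenvalue n m =
      -((n + 1) / n * (-1 / n : ℝ) ^ (m - 2)) := by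
    have h0 := hw.ne_zero
    rw [simplexEigenvalue_eq_one_sub_pow hn (by omega), show m - 1 = m - 2 + 1 by omega, pow_succ]
    field_simp
    ring
  rw [jacobianAt, RTensor.applyMat_simplexTensor hm, hw.sum_dotProduct_pow_smul,
    hw.sum_vecMulVec_self, add_sub_assoc, ← sub_smul, hcoeff, smul_smul,
    mul_comm _ (((n : ℝ) + 1) / n), neg_smul, ← sub_eq_add_neg, ← smul_sub, smul_smul,
    simplexJacobianEigenvalue_eq_div_simplexEigenvalue hn hm]

theorem matrixSpectralRadius_jacobianAt_frame (hw : IsRegularSimplexFrame w) (hn : 2 ≤ n)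
    (hm : 2 ≤ m) (j : Fin (n + 1)) :
    matrixSpectralRadius (jacobianAt (simplexTensor m w) (simplexEigenvalue n m) (w j)) =
      ENNReal.ofReal |simplexJacobianEigenvalue n m| := by
  rw [hw.jacobianAt_frame hm, matrixSpectralRadius_smul_one_sub_vecMulVec_self hn _ (hw.1 j)]

theorem roots_charpoly_jacobianAt_frame (hw : IsRegularSimplexFrame w) (hm : 2 ≤ m)
    (j : Fin (n + 1)) :
    (jacobianAt (simplexTensor m w) (simplexEigenvalue n m) (w j)).charpoly.roots =
      0 ::ₘ Multiset.replicate (n - 1) (simplexJacobianEigenvalue n m) := by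
  have : NeZero n := ⟨Nat.cast_ne_zero.1 hw.ne_zero⟩
  rw [hw.jacobianAt_frame hm, charpoly_smul_one_sub_vecMulVec_self _ (hw.1 j), Fintype.card_fin,
    roots_mul (mul_ne_zero X_ne_zero (pow_ne_zero _ (X_sub_C_ne_zero _))), roots_X, roots_pow,
    roots_X_sub_C, Multiset.nsmul_singleton, Multiset.singleton_add]

theorem isRobustEigenpair_frame_iff (hw : IsRegularSimplexFrame w) (hn : 2 ≤ n) (hm : 3 ≤ m)
    (j : Fin (n + 1)) :
    IsRobustEigenpair (simplexTensor m w) ev (w j) ↔ 7 ≤ n + m ∧ ev = simplexEigenvalue n m := by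
  have hframe := hw.isEigenpair_frame (m := m) (by omega) j
  have hrobust : IsRobustEigenpair (simplexTensor m w) (simplexEigenvalue n m) (w j) ↔
      7 ≤ n + m := by
    rw [← abs_simplexJacobianEigenvalue_lt_one_iff hn hm, IsRobustEigenpair,
      hw.matrixSpectralRadius_jacobianAt_frame hn (by omega), ENNReal.ofReal_lt_one]
    exact ⟨fun h => h.2.2, fun h => ⟨hframe, (simplexEigenvalue_pos hn (by omega)).ne', h⟩⟩
  constructor
  · intro h
    obtain rfl : ev = simplexEigenvalue n m :=
      h.1.eigenvalue_eq.trans hframe.eigenvalue_eq.symm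
    exact ⟨hrobust.1 h, rfl⟩
  · rintro ⟨h7, rfl⟩
    exact hrobust.2 h7

theorem isRobustEigenpair_iff (hw : IsRegularSimplexFrame w) (hn : 2 ≤ n) (hm : 3 ≤ m) :
    IsRobustEigenpair (simplexTensor m w) ev v ↔ 7 ≤ n + m ∧ ∃ j,
      (v = w j ∧ ev = simplexEigenvalue n m) ∨
      (v = -w j ∧ ev = (-1) ^ m * simplexEigenvalue n m) := by
  have hsign : ((-1) ^ m * (-1) ^ m : ℝ) = 1 := by rw [← mul_pow]; norm_num
  constructor
  · intro h
    obtain ⟨j, rfl | rfl⟩ := hw.eq_or_eq_neg_of_isRobustEigenpair (by omega) h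
    · obtain ⟨h7, hev⟩ := (hw.isRobustEigenpair_frame_iff hn hm j).1 h
      exact ⟨h7, j, .inl ⟨rfl, hev⟩⟩
    · have hneg := h.neg (by omega)
      rw [neg_neg, hw.isRobustEigenpair_frame_iff hn hm] at hneg
      refine ⟨hneg.1, j, .inr ⟨rfl, ?_⟩⟩
      rw [← hneg.2, ← mul_assoc, hsign, one_mul]
  · rintro ⟨h7, j, ⟨rfl, rfl⟩ | ⟨rfl, rfl⟩⟩
    · exact (hw.isRobustEigenpair_frame_iff hn hm j).2 ⟨h7, rfl⟩
    · exact ((hw.isRobustEigenpair_frame_iff hn hm j).2 ⟨h7, rfl⟩).neg (by omega)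

theorem isRobustEigenvector_iff (hw : IsRegularSimplexFrame w) (hn : 2 ≤ n) (hm : 3 ≤ m)
    (v : Fin n → ℝ) : IsRobustEigenvector (simplexTensor m w) v ↔
      7 ≤ n + m ∧ ∃ j, v = w j ∨ v = -w j := by
  simp only [IsRobustEigenvector, hw.isRobustEigenpair_iff hn hm]
  constructor
  · rintro ⟨_, h7, j, hj⟩
    exact ⟨h7, j, hj.imp And.left And.left⟩
  · rintro ⟨h7, j, hj | hj⟩
    · exact ⟨_, h7, j, .inl ⟨hj, rfl⟩⟩
    · exact ⟨_, h7, j, .inr ⟨hj, rfl⟩⟩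

theorem exists_pos_isRobustEigenpair_iff (hw : IsRegularSimplexFrame w) (hn : 2 ≤ n) (hm : 3 ≤ m)
    (v : Fin n → ℝ) : (∃ ev : ℝ, 0 < ev ∧ IsRobustEigenpair (simplexTensor m w) ev v) ↔
      7 ≤ n + m ∧ ∃ j, v = w j ∨ (Even m ∧ v = -w j) := by
  have hpos := simplexEigenvalue_pos (m := m) hn (by omega)
  simp only [hw.isRobustEigenpair_iff hn hm]
  constructor
  · rintro ⟨ev, hev, h7, j, ⟨hj, -⟩ | ⟨hj, rfl⟩⟩
    · exact ⟨h7, j, .inl hj⟩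
    · refine ⟨h7, j, .inr ⟨?_, hj⟩⟩
      by_contra hodd
      rw [(Nat.not_even_iff_odd.1 hodd).neg_one_pow] at hev
      linarith
  · rintro ⟨h7, j, hj | ⟨heven, hj⟩⟩
    · exact ⟨_, hpos, h7, j, .inl ⟨hj, rfl⟩⟩
    · exact ⟨_, by rwa [heven.neg_one_pow, one_mul], h7, j, .inr ⟨hj, rfl⟩⟩

end IsRegularSimplexFrame

theorem mainTheorem2 (n m : ℕ) (hn : 2 ≤ n) (hm : 3 ≤ m)
    (w : Fin (n + 1) → Fin n → ℝ) (hw : IsRegularSimplexFrame w) :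
    -- the robust eigenvectors are precisely the frame vectors, up to sign
    (∀ v : Fin n → ℝ, IsRobustEigenvector (simplexTensor m w) v ↔
      (7 ≤ n + m ∧ ∃ j, v = w j ∨ v = -w j)) ∧
    -- the same with the sign normalization that the eigenvalue is positive
    (∀ v : Fin n → ℝ, (∃ ev : ℝ, 0 < ev ∧ IsRobustEigenpair (simplexTensor m w) ev v) ↔
      (7 ≤ n + m ∧ ∃ j, v = w j ∨ (Even m ∧ v = -w j))) ∧
    -- the Jacobian at the frame vectors: eigenvalues with multiplicity, and spectral radius
    (∀ j : Fin (n + 1), ∀ ev : ℝ, ev = 1 + (n : ℝ) / (-(n : ℝ)) ^ m →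
      0 < ev ∧
      IsEigenpair (simplexTensor m w) ev (w j) ∧
      (jacobianAt (simplexTensor m w) ev (w j)).charpoly.roots =
        0 ::ₘ Multiset.replicate (n - 1)
          (((n : ℝ) + 1) * ((m : ℝ) - 1) / (1 + (-(n : ℝ)) ^ (m - 2) * (n : ℝ))) ∧
      (Odd m → matrixSpectralRadius (jacobianAt (simplexTensor m w) ev (w j)) =
        ENNReal.ofReal (((n : ℝ) + 1) * ((m : ℝ) - 1) / ((n : ℝ) ^ (m - 1) - 1))) ∧
      (Even m → matrixSpectralRadius (jacobianAt (simplexTensor m w) ev (w j)) =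
        ENNReal.ofReal (((n : ℝ) + 1) * ((m : ℝ) - 1) / (1 + (n : ℝ) ^ (m - 1))))) := by
  refine ⟨hw.isRobustEigenvector_iff hn hm, hw.exists_pos_isRobustEigenpair_iff hn hm, ?_⟩
  rintro j ev (rfl : ev = simplexEigenvalue n m)
  have hm2 : 2 ≤ m := by omega
  refine ⟨simplexEigenvalue_pos hn hm2, hw.isEigenpair_frame (by omega) j,
    hw.roots_charpoly_jacobianAt_frame hm2 j, fun hodd => ?_, fun heven => ?_⟩
  · rw [hw.matrixSpectralRadius_jacobianAt_frame hn hm2,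
      abs_simplexJacobianEigenvalue_of_odd hn hodd (by omega)]
  · rw [hw.matrixSpectralRadius_jacobianAt_frame hn hm2,
      abs_simplexJacobianEigenvalue_of_even heven (by omega)]
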